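/- Communication lower bound for mean estimation at the central-DP accuracy. Setting. There are $n\ge 1$ clients; client $i$ holds $x_i\in\mathcal B_2(C)=\{v\in\mathbb R^d:\|v\|_2\le C\}$, where $d\ge1$ and $C>0$. A (possibly interactive) compressor works as follows: the clients write bits one after another; which client writes next is determined by the randomness of the scheme (shared seed and local coins) and the bits written so far, and the bit it writes is a function of its own vector, the randomness and the bits written so far. From the randomness and the final transcript one obtains local reports $Y_1,\dots,Y_n\in\mathbb R^d$. The compressor is $b$-bit if every client always writes at most $b$ bits in total. It is unbiased if, for all $x_1,\dots,x_n\in\mathcal B_2(C)$, the expectation exists and $$\mathbb E\Big[\sum_{i} Y_i\Big]=\sum_{i} x_i .$$ Theorem. For all constants $K,A>0$ there is a constant $c=c(K,A)>0$ such that the following holds for all $n,d\ge1$, $b\in\{0,1,2,\dots\}$, $C>0$, $\varepsilon>0$ and $\delta\in(0,1)$ with $$\min\Big(b,\ \frac{n\varepsilon^2}{\log(1/\delta)}\Big)\le A\,d .$$ If an unbiased $b$-bit (possibly interactive) compressor satisfies, for all $x_1,\dots,x_n\in\mathcal B_2(C)$, $$\mathbb E\left[\Big\|\frac1n\sum_i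 Y_i-\frac1n\sum_i x_i\Big\|_2^2\right]\le K\,\frac{C^2 d\log(1/\delta)}{n^2\varepsilon^2},$$ then $$b\ \ge\ c\,\frac{n\varepsilon^2}{\log(1/\delta)} .$$ -/

import Mathlib

open MeasureTheory

/-- The closed Euclidean ball of radius `C` about the origin of `ℝ^d`: the data space of a client. -/
abbrev DataBall (d : ℕ) (C : ℝ) : Type :=
  Metric.closedBall (0 : EuclideanSpace ℝ (Fin d)) C

/-- A randomized, fully interactive compression scheme for `n` clients with data in `X` and
reports in `V`. The clients write bits one after the other; everyone sees all the bits written so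
far (a history, of type `List Bool`). A point `ω : Ω` collects the whole randomness of the scheme,
the shared seed as well as the coins of the individual clients. No restriction is imposed on which
party may look at which part of `ω`, so that schemes with private coins are particular cases.
* `rounds` is the number of bits that are written altogether;
* `speaker ω h` is the client who writes the next bit after the history `h`;
* `bit ω h v` is that bit, when the datum of that client is `v`;
* `report ω h i` is the local report of client `i`, as reconstructed from the final history `h`. -/
structure Compressor (Ω X V : Type*) (n : ℕ) where
  rounds : ℕ
  speaker : Ω → List Bool → Fin n
  bit : Ω → List Bool → X → Bool
  report : Ω → List Bool → Fin n → V

namespace Compressor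

variable {Ω X V : Type*} {n : ℕ}

/-- The bits that have been written after `t` rounds when client `i` holds the datum `x i`. -/
def history (S : Compressor Ω X V n) (ω : Ω) (x : Fin n → X) : ℕ → List Bool
  | 0 => []
  | t + 1 =>
    S.history ω x t ++ [S.bit ω (S.history ω x t) (x (S.speaker ω (S.history ω x t)))]

/-- The total number of bits written by client `i`. -/
def bitsSent (S : Compressor Ω X V n) (ω : Ω) (x : Fin n → X) (i : Fin n) : ℕ :=
  ((Finset.range S.rounds).filter fun t => S.speaker ω (S.history ω x t) = i).card

/-- Each client always writes at most `b` bits. -/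
def IsBBit (S : Compressor Ω X V n) (b : ℕ) : Prop :=
  ∀ (ω : Ω) (x : Fin n → X) (i : Fin n), S.bitsSent ω x i ≤ b

/-- The local report `Y_i` of client `i`. -/
def Y (S : Compressor Ω X V n) (x : Fin n → X) (i : Fin n) (ω : Ω) : V :=
  S.report ω (S.history ω x S.rounds) i

/-- For all data `x_1, …, x_n` in the ball, `E[∑ Y_i] = ∑ x_i` (and the expectation exists). -/
def IsUnbiased [MeasurableSpace Ω] {d : ℕ} {C : ℝ}
    (S : Compressor Ω (DataBall d C) (EuclideanSpace ℝ (Fin d)) n) (P : Measure Ω) : Prop :=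
  ∀ x : Fin n → DataBall d C,
    Integrable (fun ω => ∑ i, S.Y x i ω) P ∧
      ∫ ω, ∑ i, S.Y x i ω ∂P = ∑ i, (x i : EuclideanSpace ℝ (Fin d))

/-- The mean-squared error `E ‖(1/n) ∑ Y_i - (1/n) ∑ x_i‖²` at the data `x`, in `[0, ∞]`. -/
noncomputable def mse [MeasurableSpace Ω] {d : ℕ} {C : ℝ}
    (S : Compressor Ω (DataBall d C) (EuclideanSpace ℝ (Fin d)) n) (P : Measure Ω)
    (x : Fin n → DataBall d C) : ENNReal :=
  ∫⁻ ω, ‖(1 / (n : ℝ)) • ∑ i, S.Y x i ω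
      - (1 / (n : ℝ)) • ∑ i, (x i : EuclideanSpace ℝ (Fin d))‖ₑ ^ 2 ∂P

end Compressor

/-! ### Estimation from a map with rectangular fibres on a finite power. -/

section FiniteProduct

open Finset Function

variable {ι U β : Type*} [DecidableEq ι] [DecidableEq β]

/-! Fix the randomness and draw the data independently and uniformly from a finite grid in the ball.
Inputs with the same transcript form a rectangle (`history_update`), so the data stay independent
given the transcript, and the error in estimating their sum is at least the sum of the conditional
variances (`sum_norm_sub_mean_le`). When one client's datum varies, at most `2 ^ b` transcripts
occur (Kraft), so an exponential moment and Jensen (`sum_le_card_mul_log`) bound each conditional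
variance below by `(d * -log ψ - b) * C² / (l * d)`, where `ψ` bounds the one-dimensional mean of
`exp (-l (g - z)²)`.

Unbiasedness permits comparing the report average with `t` times the sum for any `t > 0`, at the
cost of a known bias. Write the allowed error as `C² / n * r`, with `r = K d / T` and `T = n ε² /
log (1/δ)`. Signs with an inflated `t` give `d ≤ 2 (r + 1) b` for every `r`. This suffices if `T ≤ A
d`. Otherwise `b ≤ A d`, and a fine grid with `t = 1 / n` bounds `r` below, hence `T = O(d)`; as
also `r ≤ K / A`, the first bound gives `d = O(b)`. -/

/-- Resampling one coordinate does not change a sum over a finite power. -/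
theorem sum_sum_update [Fintype ι] [Fintype U] (i : ι) (g : (ι → U) → ℝ) :
    ∑ x : ι → U, ∑ v, g (update x i v) = Fintype.card U * ∑ x, g x := by
  -- Exchanging the `i`-th coordinate of `x` with `v` is an involution of the pairs.
  have h : ∑ p : (ι → U) × U, g (update p.1 i p.2) = ∑ p : (ι → U) × U, g p.1 := by
    refine Finset.sum_bij' (fun p _ => (update p.1 i p.2, p.1 i))
      (fun p _ => (update p.1 i p.2, p.1 i)) ?_ ?_ ?_ ?_ ?_ <;> simp
  rw [Fintype.sum_prod_type, Fintype.sum_prod_type] at h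
  rw [h]
  simp [Finset.mul_sum]

/-- If resampling coordinate `i` produces at most `q` values of `H`, then a function of `H x` and
`x i` whose exponential has mean at most `φ` for every fixed value of `H` has mean at most
`log (q φ)`. -/
theorem sum_le_card_mul_log [Fintype ι] [Fintype U] (H : (ι → U) → β) (i : ι) {q φ : ℝ} (hq : 0 < q) (hφ : 0 < φ)
    (hcount : ∀ x, ((univ.image fun v => H (update x i v)).card : ℝ) ≤ q)
    (f : β → U → ℝ) (hf : ∀ h, ∑ v, Real.exp (f h v) ≤ Fintype.card U * φ) :
    ∑ x : ι → U, f (H x) (x i) ≤ Fintype.card (ι → U) * Real.log (q * φ) := by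
  rcases isEmpty_or_nonempty U with hU | hU
  · have : IsEmpty (ι → U) := ⟨fun x => hU.elim (x i)⟩
    simp
  have hcU : (0 : ℝ) < Fintype.card U := by exact_mod_cast Fintype.card_pos
  have hqφ : 0 < q * φ := mul_pos hq hφ
  have hexp : ∑ x : ι → U, Real.exp (f (H x) (x i)) ≤ Fintype.card (ι → U) * (q * φ) := by
    have h := sum_sum_update i fun x : ι → U => Real.exp (f (H x) (x i))
    have h2 : ∀ x : ι → U, ∑ v, Real.exp (f (H (update x i v)) (update x i v i)) ≤
        q * (Fintype.card U * φ) := by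
      intro x
      -- Summing over all attainable values removes the dependence of `h` on `v`, at the cost of a
      -- factor `q`.
      calc ∑ v, Real.exp (f (H (update x i v)) (update x i v i))
          ≤ ∑ v, ∑ h ∈ univ.image fun v => H (update x i v), Real.exp (f h v) := by
            refine Finset.sum_le_sum fun v _ => ?_
            rw [update_self]
            exact Finset.single_le_sum (f := fun h => Real.exp (f h v))
              (fun h _ => (Real.exp_pos _).le)
              (Finset.mem_image_of_mem (fun v => H (update x i v)) (mem_univ v))
        _ = ∑ h ∈ univ.image fun v => H (update x i v), ∑ v, Real.exp (f h v) :=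
            Finset.sum_comm
        _ ≤ ∑ h ∈ univ.image fun v => H (update x i v), Fintype.card U * φ :=
            Finset.sum_le_sum fun h _ => hf h
        _ ≤ q * (Fintype.card U * φ) := by
            rw [Finset.sum_const, nsmul_eq_mul]
            exact mul_le_mul_of_nonneg_right (hcount x) (by positivity)
    have h3 := Finset.sum_le_sum fun (x : ι → U) (_ : x ∈ univ) => h2 x
    rw [h, Finset.sum_const, nsmul_eq_mul, Finset.card_univ] at h3
    refine le_of_mul_le_mul_left (h3.trans_eq ?_) hcU
    ring
  -- Jensen's inequality for `log`, as its tangent line at `q * φ`.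
  have hpt : ∀ x : ι → U, f (H x) (x i) ≤
      Real.log (q * φ) + (Real.exp (f (H x) (x i)) / (q * φ) - 1) := by
    intro x
    have := Real.add_one_le_exp (f (H x) (x i) - Real.log (q * φ))
    rw [Real.exp_sub, Real.exp_log hqφ] at this
    linarith
  refine (Finset.sum_le_sum fun x _ => hpt x).trans ?_
  rw [Finset.sum_add_distrib, Finset.sum_sub_distrib, ← Finset.sum_div]
  simp only [Finset.sum_const, nsmul_eq_mul, Finset.card_univ, mul_one]
  have := (div_le_iff₀ hqφ).2 hexp
  linarith

variable {E : Type*} [NormedAddCommGroup E] [InnerProductSpace ℝ E]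

/-- Functions of different coordinates are orthogonal over a set that is closed under exchanging
coordinates, as soon as one of them is centred. -/
theorem sum_inner_eq_zero_of_update_mem (F : Finset (ι → U))
    (hF : ∀ x ∈ F, ∀ y ∈ F, ∀ i, update x i (y i) ∈ F) {i k : ι} (hik : i ≠ k)
    (g g' : U → E) (hg : ∑ x ∈ F, g (x i) = 0) :
    ∑ x ∈ F, inner ℝ (g (x i)) (g' (x k)) = 0 := by
  rcases F.eq_empty_or_nonempty with rfl | hne
  · simp
  -- Swapping the `i`-th coordinates of two points of `F` decouples coordinate `i` from coordinate
  -- `k`.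
  have h : ∑ p ∈ F ×ˢ F, inner ℝ (g (p.1 i)) (g' (p.1 k)) =
      ∑ p ∈ F ×ˢ F, inner ℝ (g (p.2 i)) (g' (p.1 k)) := by
    refine Finset.sum_bij' (fun p _ => (update p.1 i (p.2 i), update p.2 i (p.1 i)))
      (fun p _ => (update p.1 i (p.2 i), update p.2 i (p.1 i))) ?_ ?_ ?_ ?_ ?_
    · intro p hp
      rw [mem_product] at hp ⊢
      exact ⟨hF _ hp.1 _ hp.2 i, hF _ hp.2 _ hp.1 i⟩
    · intro p hp
      rw [mem_product] at hp ⊢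
      exact ⟨hF _ hp.1 _ hp.2 i, hF _ hp.2 _ hp.1 i⟩
    · intro p _; simp
    · intro p _; simp
    · intro p _; simp [update_of_ne hik.symm]
  rw [Finset.sum_product, Finset.sum_product] at h
  simp only [Finset.sum_const, nsmul_eq_mul, ← sum_inner, hg, inner_zero_left, mul_zero,
    ← Finset.mul_sum, mul_eq_zero] at h
  simpa [hne.ne_empty] using h

/-- Pythagoras' theorem for centred functions of the different coordinates. -/
theorem sum_norm_sum_sq [Fintype ι] (F : Finset (ι → U))
    (hF : ∀ x ∈ F, ∀ y ∈ F, ∀ i, update x i (y i) ∈ F) (D : ι → U → E)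
    (hD : ∀ i, ∑ x ∈ F, D i (x i) = 0) :
    ∑ x ∈ F, ‖∑ i, D i (x i)‖ ^ 2 = ∑ i, ∑ x ∈ F, ‖D i (x i)‖ ^ 2 := by
  simp only [← real_inner_self_eq_norm_sq, sum_inner, inner_sum]
  rw [Finset.sum_comm]
  refine Finset.sum_congr rfl fun i _ => ?_
  rw [Finset.sum_comm]
  refine Finset.sum_eq_single i (fun k _ hk => ?_) (by simp)
  exact sum_inner_eq_zero_of_update_mem F hF hk (D k) (D i) (hD k)

/-- On a set that is closed under exchanging coordinates, predicting a sum of functions of the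
coordinates is at least as hard as predicting the summands by their means. -/
theorem sum_norm_sub_mean_le [Fintype ι] (F : Finset (ι → U))
    (hF : ∀ x ∈ F, ∀ y ∈ F, ∀ i, update x i (y i) ∈ F) (e : U → E) (z : E) :
    ∑ i, ∑ x ∈ F, ‖e (x i) - (F.card : ℝ)⁻¹ • ∑ y ∈ F, e (y i)‖ ^ 2 ≤
      ∑ x ∈ F, ‖z - ∑ i, e (x i)‖ ^ 2 := by
  set m : ι → E := fun i => (F.card : ℝ)⁻¹ • ∑ y ∈ F, e (y i) with hm
  have hD : ∀ i, ∑ x ∈ F, (e (x i) - m i) = 0 := by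
    intro i
    rcases F.eq_empty_or_nonempty with rfl | hne
    · simp
    have : (F.card : ℝ) ≠ 0 := by exact_mod_cast hne.card_pos.ne'
    rw [Finset.sum_sub_distrib, Finset.sum_const, ← Nat.cast_smul_eq_nsmul ℝ, hm, smul_smul,
      mul_inv_cancel₀ this, one_smul, sub_self]
  have hsq := sum_norm_sum_sq F hF (fun i u => e u - m i) hD
  have hpt : ∀ x : ι → U, ‖z - ∑ i, e (x i)‖ ^ 2 = ‖z - ∑ i, m i‖ ^ 2
      - 2 * inner ℝ (z - ∑ i, m i) (∑ i, (e (x i) - m i)) + ‖∑ i, (e (x i) - m i)‖ ^ 2 := by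
    intro x
    rw [← norm_sub_sq_real, Finset.sum_sub_distrib, sub_sub_sub_cancel_right]
  have hcross : ∑ x ∈ F, inner ℝ (z - ∑ i, m i) (∑ i, (e (x i) - m i)) = 0 := by
    rw [← inner_sum, Finset.sum_comm, Finset.sum_eq_zero fun i _ => hD i, inner_zero_right]
  rw [Finset.sum_congr rfl fun x _ => hpt x, Finset.sum_add_distrib, Finset.sum_sub_distrib,
    ← Finset.mul_sum, hcross, hsq]
  have : 0 ≤ ∑ x ∈ F, ‖z - ∑ i, m i‖ ^ 2 := Finset.sum_nonneg fun _ _ => by positivity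
  linarith

/-- Lower bound for the error of any estimate of `∑ i, e (x i)` that is a function of `H x`. -/
theorem card_mul_le_sum_norm_sub_sq [Fintype ι] [Fintype U] (H : (ι → U) → β) {q φ l : ℝ} (hq : 0 < q) (hφ : 0 < φ)
    (hl : 0 < l) (hrect : ∀ x y i, H x = H y → H (update x i (y i)) = H x)
    (hcount : ∀ i x, ((univ.image fun v => H (update x i v)).card : ℝ) ≤ q)
    (e : U → E) (he : ∀ m, ∑ v, Real.exp (-(l * ‖e v - m‖ ^ 2)) ≤ Fintype.card U * φ)
    (z : β → E) :
    Fintype.card (ι → U) * (Fintype.card ι * (-Real.log (q * φ) / l)) ≤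
      ∑ x : ι → U, ‖z (H x) - ∑ i, e (x i)‖ ^ 2 := by
  set F : β → Finset (ι → U) := fun h => univ.filter fun x => H x = h with hFdef
  set m : β → ι → E := fun h i => ((F h).card : ℝ)⁻¹ • ∑ y ∈ F h, e (y i) with hm
  have hF : ∀ h, ∀ x ∈ F h, ∀ y ∈ F h, ∀ i, update x i (y i) ∈ F h := by
    intro h x hx y hy i
    simp only [hFdef, mem_filter, mem_univ, true_and] at hx hy ⊢
    rw [hrect x y i (hx.trans hy.symm), hx]
  have hfib : ∀ g : β → (ι → U) → ℝ,
      ∑ x, g (H x) x = ∑ h ∈ univ.image H, ∑ x ∈ F h, g h x := by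
    intro g
    rw [← Finset.sum_fiberwise_of_maps_to (s := univ) (t := univ.image H) (g := H)
      (fun x _ => mem_image_of_mem H (mem_univ x))]
    refine Finset.sum_congr rfl fun h _ => Finset.sum_congr rfl fun x hx => ?_
    rw [(mem_filter.1 hx).2]
  -- On each fibre of `H` the estimate is constant and exchanges are allowed, so conditional
  -- variances add up.
  have hmain : ∑ i, ∑ x : ι → U, ‖e (x i) - m (H x) i‖ ^ 2 ≤
      ∑ x : ι → U, ‖z (H x) - ∑ i, e (x i)‖ ^ 2 := by
    rw [hfib fun h x => ‖z h - ∑ i, e (x i)‖ ^ 2, Finset.sum_comm,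
      hfib fun h x => ∑ i, ‖e (x i) - m h i‖ ^ 2]
    refine Finset.sum_le_sum fun h _ => ?_
    rw [Finset.sum_comm]
    exact sum_norm_sub_mean_le (F h) (hF h) e (z h)
  refine le_trans ?_ hmain
  have hi : ∀ i, Fintype.card (ι → U) * (-Real.log (q * φ) / l) ≤
      ∑ x : ι → U, ‖e (x i) - m (H x) i‖ ^ 2 := by
    intro i
    have := sum_le_card_mul_log H i hq hφ (hcount i)
      (fun h v => -(l * ‖e v - m h i‖ ^ 2)) fun h => he (m h i)
    rw [Finset.sum_neg_distrib, ← Finset.mul_sum] at this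
    rw [← mul_div_assoc, div_le_iff₀ hl]
    linarith
  calc _ = ∑ i : ι, (Fintype.card (ι → U) * (-Real.log (q * φ) / l) : ℝ) := by
        rw [Finset.sum_const, nsmul_eq_mul, Finset.card_univ]; ring
    _ ≤ _ := Finset.sum_le_sum fun i _ => hi i

end FiniteProduct

/-! ### Transcripts: rectangles, Kraft's inequality, and error at fixed randomness. -/

namespace Compressor

open Finset Function

variable {Ω X V : Type*} {n : ℕ}

/-- The inputs that lead to a given history form a combinatorial rectangle. -/
theorem history_update (S : Compressor Ω X V n) (ω : Ω) (x y : Fin n → X) (i : Fin n) (t : ℕ)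
    (h : S.history ω x t = S.history ω y t) :
    S.history ω (update x i (y i)) t = S.history ω x t := by
  induction t with
  | zero => rfl
  | succ t ih =>
    simp only [history] at h ⊢
    obtain ⟨h1, h2⟩ := List.append_inj' h rfl
    rw [ih h1]
    rw [← h1] at h2
    by_cases hs : S.speaker ω (S.history ω x t) = i
    · rw [hs] at h2 ⊢
      rw [update_self, h2]
    · rw [update_of_ne hs]

/-- The number of bits of the history `h` that were written by client `i`. -/
def bitsOf (S : Compressor Ω X V n) (ω : Ω) (i : Fin n) (h : List Bool) : ℕ :=
  ((range h.length).filter fun t => S.speaker ω (h.take t) = i).card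

theorem bitsOf_append (S : Compressor Ω X V n) (ω : Ω) (i : Fin n) (h : List Bool) (c : Bool) :
    S.bitsOf ω i (h ++ [c]) = S.bitsOf ω i h + if S.speaker ω h = i then 1 else 0 := by
  have h1 : ((range h.length).filter fun t => S.speaker ω ((h ++ [c]).take t) = i) =
      (range h.length).filter fun t => S.speaker ω (h.take t) = i := by
    refine Finset.filter_congr fun t ht => ?_
    rw [List.take_append_of_le_length (mem_range.1 ht).le]
  unfold bitsOf
  rw [List.length_append, List.length_singleton, Finset.range_add_one, Finset.filter_insert, h1,
    List.take_left]
  split_ifs with hs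
  · rw [Finset.card_insert_of_notMem (by simp)]
  · simp

theorem bitsOf_history (S : Compressor Ω X V n) (ω : Ω) (x : Fin n → X) (i : Fin n) (t : ℕ) :
    S.bitsOf ω i (S.history ω x t) =
      ((range t).filter fun s => S.speaker ω (S.history ω x s) = i).card := by
  induction t with
  | zero => rfl
  | succ t ih =>
    rw [history, bitsOf_append, ih, Finset.range_add_one, Finset.filter_insert]
    split_ifs with hs
    · rw [Finset.card_insert_of_notMem (by simp)]
    · simp

/-- Kraft's inequality for the histories that one client can bring about. -/
theorem sum_image_history_le_one {U : Type*} [Fintype U] (S : Compressor Ω X V n) (ω : Ω)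
    (x : Fin n → X) (i : Fin n) (e : U → X) (t : ℕ) :
    ∑ h ∈ univ.image fun v => S.history ω (update x i (e v)) t,
      (1 / 2 : ℝ) ^ S.bitsOf ω i h ≤ 1 := by
  classical
  induction t with
  | zero =>
    refine (Finset.sum_le_sum_of_subset_of_nonneg (t := {[]}) ?_ ?_).trans ?_
    · intro h
      simp [history, eq_comm]
    · intros; positivity
    · simp [bitsOf]
  | succ t ih =>
    set I := univ.image fun v => S.history ω (update x i (e v)) t with hI
    -- The possible next bits: both if client `i` speaks, otherwise one, as the other data are
    -- fixed.
    set J : List Bool → Finset Bool := fun h =>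
      if S.speaker ω h = i then univ else {S.bit ω h (x (S.speaker ω h))} with hJ
    have hsub : (univ.image fun v => S.history ω (update x i (e v)) (t + 1)) ⊆
        (I.sigma J).image fun p => p.1 ++ [p.2] := by
      intro h hh
      obtain ⟨v, -, rfl⟩ := mem_image.1 hh
      refine mem_image.2 ⟨⟨S.history ω (update x i (e v)) t, _⟩, mem_sigma.2 ⟨?_, ?_⟩, rfl⟩
      · exact mem_image_of_mem (fun v => S.history ω (update x i (e v)) t) (mem_univ v)
      · simp only [hJ]
        split_ifs with hs
        · exact mem_univ _
        · rw [update_of_ne hs]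
          exact mem_singleton_self _
    refine (Finset.sum_le_sum_of_subset_of_nonneg hsub fun _ _ _ => by positivity).trans ?_
    rw [Finset.sum_image, Finset.sum_sigma]
    · refine le_trans (Finset.sum_le_sum fun h _ => ?_) ih
      simp only [bitsOf_append, hJ]
      split_ifs with hs
      · simp only [Fintype.sum_bool, pow_succ]
        linarith
      · simp
    · rintro ⟨h, c⟩ - ⟨h', c'⟩ - heq
      obtain ⟨h1, h2⟩ := List.append_inj' heq rfl
      obtain rfl : h = h' := h1
      obtain rfl : c = c' := by simpa using h2
      rfl

/-- Every term of the Kraft sum is at least `2 ^ (-b)`. The rounds in which client `i` speaks may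
vary with the transcript. -/
theorem IsBBit.card_image_history_le {U : Type*} [Fintype U] {S : Compressor Ω X V n} {b : ℕ}
    (hS : S.IsBBit b) (ω : Ω) (x : Fin n → X) (i : Fin n) (e : U → X) :
    ((univ.image fun v => S.history ω (update x i (e v)) S.rounds).card : ℝ) ≤ 2 ^ b := by
  have h := S.sum_image_history_le_one ω x i e S.rounds
  have hle : ∑ h ∈ univ.image fun v => S.history ω (update x i (e v)) S.rounds, (1 / 2 : ℝ) ^ b ≤
      1 := by
    refine le_trans (Finset.sum_le_sum fun h hh => ?_) h
    obtain ⟨v, -, rfl⟩ := mem_image.1 hh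
    refine pow_le_pow_of_le_one (by norm_num) (by norm_num) ?_
    rw [bitsOf_history]
    exact hS ω _ i
  rw [Finset.sum_const, nsmul_eq_mul, one_div, inv_pow, ← div_eq_mul_inv,
    div_le_one (by positivity)] at hle
  exact hle

/-- Average error, over independent uniform data in a finite family, of a `b`-bit scheme with fixed
randomness as an estimate of a multiple of the sum of the data. -/
theorem IsBBit.card_mul_le_sum_norm_sub_sq {U E : Type*} [Fintype U] [NormedAddCommGroup E]
    [InnerProductSpace ℝ E] {S : Compressor Ω X V n} {b : ℕ} (hS : S.IsBBit b) (ω : Ω)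
    (e : U → X) (p : X → E) {φ l : ℝ} (hφ : 0 < φ) (hl : 0 < l)
    (he : ∀ m, ∑ v, Real.exp (-(l * ‖p (e v) - m‖ ^ 2)) ≤ Fintype.card U * φ)
    (z : List Bool → E) {t : ℝ} (ht : 0 < t) :
    Fintype.card (Fin n → U) * (t ^ 2 * (n * ((-Real.log φ - b) / l))) ≤
      ∑ x : Fin n → U,
        ‖z (S.history ω (e ∘ x) S.rounds) - t • ∑ i, p (e (x i))‖ ^ 2 := by
  have hupd : ∀ (x : Fin n → U) (i : Fin n) (v : U), e ∘ update x i v = update (e ∘ x) i (e v) :=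
    fun x i v => comp_update e x i v
  have h := _root_.card_mul_le_sum_norm_sub_sq (E := E)
    (fun x : Fin n → U => S.history ω (e ∘ x) S.rounds)
    (q := 2 ^ b) (by positivity) hφ hl
    (fun x y i hxy => by
      simpa only [hupd, comp_apply] using S.history_update ω (e ∘ x) (e ∘ y) i S.rounds hxy)
    (fun i x => by
      simpa only [hupd] using hS.card_image_history_le ω (e ∘ x) i e)
    (fun v => p (e v)) he (fun h => t⁻¹ • z h)
  -- Uses only `log 2 ≤ 1`.
  have hlog : -Real.log φ - b ≤ -Real.log (2 ^ b * φ) := by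
    rw [Real.log_mul (by positivity) hφ.ne', Real.log_pow]
    have : (b : ℝ) * Real.log 2 ≤ b * 1 :=
      mul_le_mul_of_nonneg_left (by linarith [Real.log_two_lt_d9]) (Nat.cast_nonneg b)
    linarith
  have hterm : ∀ x : Fin n → U,
      ‖z (S.history ω (e ∘ x) S.rounds) - t • ∑ i, p (e (x i))‖ ^ 2 =
        t ^ 2 * ‖t⁻¹ • z (S.history ω (e ∘ x) S.rounds) - ∑ i, p (e (x i))‖ ^ 2 := by
    intro x
    rw [← mul_pow, ← Real.norm_of_nonneg ht.le, ← norm_smul, Real.norm_of_nonneg ht.le, smul_sub,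
      smul_inv_smul₀ ht.ne']
  simp only [hterm, ← Finset.mul_sum]
  calc _ = t ^ 2 * (Fintype.card (Fin n → U) * (n * ((-Real.log φ - b) / l))) := by ring
    _ ≤ t ^ 2 * (Fintype.card (Fin n → U) * (Fintype.card (Fin n) *
        (-Real.log (2 ^ b * φ) / l))) := by
      rw [Fintype.card_fin]
      gcongr
    _ ≤ _ := by gcongr

end Compressor

/-! ### Priors on grids in the inscribed cube. -/

section Grid

open Finset

variable {I : Type*} {d : ℕ} {C : ℝ}

/-- The point of the ball of radius `C` whose coordinates are the values of `g`, scaled to the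
cube that is inscribed in the ball. -/
noncomputable def gridPoint (hC : 0 ≤ C) (g : I → ℝ) (hg : ∀ k, |g k| ≤ 1) (v : Fin d → I) :
    DataBall d C :=
  ⟨WithLp.toLp 2 fun j => C / √d * g (v j), by
    rw [mem_closedBall_zero_iff, ← pow_le_pow_iff_left₀ (norm_nonneg _) hC two_ne_zero,
      EuclideanSpace.real_norm_sq_eq]
    rcases Nat.eq_zero_or_pos d with rfl | hd
    · simpa using sq_nonneg C
    have hd' : (0 : ℝ) < d := by exact_mod_cast hd
    calc ∑ j : Fin d, (C / √d * g (v j)) ^ 2 ≤ ∑ _j : Fin d, C ^ 2 / d := by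
          refine Finset.sum_le_sum fun j _ => ?_
          rw [mul_pow, div_pow, Real.sq_sqrt hd'.le]
          have : g (v j) ^ 2 ≤ 1 := (sq_le_one_iff_abs_le_one _).2 (hg _)
          exact mul_le_of_le_one_right (by positivity) this
      _ = C ^ 2 := by
          rw [Finset.sum_const, Finset.card_univ, Fintype.card_fin, nsmul_eq_mul]
          field_simp⟩

/-- The squared norm splits over coordinates, so the sum factorises; the side `C / √d` turns `l * d
/ C ^ 2` into `l`. -/
theorem sum_exp_gridPoint_le [Fintype I] (hd : 0 < d) (hC : 0 < C) (g : I → ℝ)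
    (hg : ∀ k, |g k| ≤ 1) {l ψ : ℝ}
    (hψ : ∀ z, ∑ k, Real.exp (-(l * (g k - z) ^ 2)) ≤ Fintype.card I * ψ)
    (m : EuclideanSpace ℝ (Fin d)) :
    ∑ v : Fin d → I, Real.exp (-(l * d / C ^ 2 *
        ‖(gridPoint hC.le g hg v : EuclideanSpace ℝ (Fin d)) - m‖ ^ 2)) ≤
      Fintype.card (Fin d → I) * ψ ^ d := by
  have hd' : (0 : ℝ) < d := by exact_mod_cast hd
  have hs : 0 < √(d : ℝ) := Real.sqrt_pos.2 hd'
  have hterm : ∀ v : Fin d → I, Real.exp (-(l * d / C ^ 2 *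
        ‖(gridPoint hC.le g hg v : EuclideanSpace ℝ (Fin d)) - m‖ ^ 2)) =
      ∏ j, Real.exp (-(l * (g (v j) - √d / C * m j) ^ 2)) := by
    intro v
    rw [← Real.exp_sum, EuclideanSpace.real_norm_sq_eq, Finset.mul_sum, ← Finset.sum_neg_distrib]
    congr 1
    refine Finset.sum_congr rfl fun j _ => ?_
    have : C / √d * g (v j) - m j = C / √d * (g (v j) - √d / C * m j) := by
      field_simp
    simp only [gridPoint, PiLp.sub_apply, this]
    rw [mul_pow, div_pow, Real.sq_sqrt hd'.le]
    field_simp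
  simp only [hterm]
  have hprod := Finset.prod_univ_sum (fun _ : Fin d => (univ : Finset I))
    fun j k => Real.exp (-(l * (g k - √d / C * m j) ^ 2))
  rw [Fintype.piFinset_univ] at hprod
  rw [← hprod]
  calc _ ≤ ∏ _j : Fin d, (Fintype.card I * ψ) :=
        Finset.prod_le_prod (fun _ _ => Finset.sum_nonneg fun _ _ => (Real.exp_pos _).le)
          fun j _ => hψ _
    _ = _ := by simp [mul_pow]

/-- The mean is `exp (-1/2) * exp (-z²/2) * cosh z`, and `cosh z ≤ exp (z²/2)`. -/
theorem sum_exp_sign_le (z : ℝ) :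
    ∑ k : Bool, Real.exp (-(1 / 2 * ((bif k then 1 else -1 : ℝ) - z) ^ 2)) ≤
      Fintype.card Bool * Real.exp (-(1 / 2)) := by
  have h := Real.cosh_le_exp_half_sq z
  rw [Real.cosh_eq] at h
  have h1 : Real.exp (-(1 / 2 * (1 - z) ^ 2)) =
      Real.exp (-(1 / 2)) * (Real.exp z * Real.exp (-(z ^ 2 / 2))) := by
    rw [← Real.exp_add, ← Real.exp_add]; ring_nf
  have h2 : Real.exp (-(1 / 2 * (-1 - z) ^ 2)) =
      Real.exp (-(1 / 2)) * (Real.exp (-z) * Real.exp (-(z ^ 2 / 2))) := by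
    rw [← Real.exp_add, ← Real.exp_add]; ring_nf
  have h3 : Real.exp (z ^ 2 / 2) * Real.exp (-(z ^ 2 / 2)) = 1 := by
    rw [← Real.exp_add]; simp
  have h4 : (Real.exp z + Real.exp (-z)) * Real.exp (-(z ^ 2 / 2)) ≤ 2 := by
    have := mul_le_mul_of_nonneg_right h (Real.exp_pos (-(z ^ 2 / 2))).le
    rw [h3] at this
    linarith
  simp only [Fintype.sum_bool, cond_true, cond_false, h1, h2, Fintype.card_bool]
  have := mul_le_mul_of_nonneg_left h4 (Real.exp_pos (-(1 / 2))).le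
  push_cast
  linarith

/-- On a sufficiently fine grid and for a sufficiently large `l`, the mean of `exp (-l (g - z)²)` is
as small as we please. -/
theorem exists_grid_sum_exp_le {ψ : ℝ} (hψ : 0 < ψ) :
    ∃ (m : ℕ) (l : ℝ) (g : Fin m → ℝ), 0 < m ∧ 0 < l ∧ (∀ k, |g k| ≤ 1) ∧
      ∀ z, ∑ k, Real.exp (-(l * (g k - z) ^ 2)) ≤ Fintype.card (Fin m) * ψ := by
  obtain ⟨m, hm⟩ := exists_nat_gt (2 / ψ)
  have hm0 : (0 : ℝ) < m := lt_trans (by positivity) hm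
  -- `l` is chosen so that half the spacing, `1 / (2 * m)`, gives the exponent `2 / ψ`. At most one
  -- grid point is closer to `z`; its term is at most `1 < m * ψ / 2`.
  refine ⟨m, 4 * m ^ 2 * (2 / ψ), fun k => k / m, by exact_mod_cast hm0, by positivity, fun k => ?_, fun z => ?_⟩
  · rw [abs_of_nonneg (by positivity), div_le_one hm0]
    exact_mod_cast k.2.le
  set l : ℝ := 4 * m ^ 2 * (2 / ψ)
  set B : Finset (Fin m) := univ.filter fun k => |(k : ℝ) / m - z| < 1 / (2 * m)
  have hB : B.card ≤ 1 := by
    refine Finset.card_le_one.2 fun k hk k' hk' => ?_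
    have h1 := abs_lt.1 (mem_filter.1 hk).2
    have h2 := abs_lt.1 (mem_filter.1 hk').2
    have h3 : |(k : ℝ) / m - k' / m| < 1 / m := by
      have : (1 : ℝ) / m = 1 / (2 * m) + 1 / (2 * m) := by field_simp; norm_num
      rw [abs_lt, this]
      constructor <;> linarith [h1.1, h1.2, h2.1, h2.2]
    rw [← sub_div, abs_div, abs_of_pos hm0, div_lt_div_iff_of_pos_right hm0] at h3
    have h4 : |((k : ℕ) : ℤ) - ((k' : ℕ) : ℤ)| < 1 := by exact_mod_cast h3
    rw [Int.abs_lt_one_iff] at h4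
    ext
    omega
  have hpt : ∀ k : Fin m, Real.exp (-(l * ((k : ℝ) / m - z) ^ 2)) ≤
      (if k ∈ B then 1 else 0) + ψ / 2 := by
    intro k
    split_ifs with hk
    · have : Real.exp (-(l * ((k : ℝ) / m - z) ^ 2)) ≤ 1 := Real.exp_le_one_iff.2 (by
        have : 0 ≤ l * ((k : ℝ) / m - z) ^ 2 := by positivity
        linarith)
      linarith
    · have hk' : 1 / (2 * m) ≤ |(k : ℝ) / m - z| := by
        simpa [B] using hk
      have hsq : (1 / (2 * m)) ^ 2 ≤ ((k : ℝ) / m - z) ^ 2 := by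
        rw [← sq_abs ((k : ℝ) / m - z)]
        exact pow_le_pow_left₀ (by positivity) hk' 2
      have hle : 2 / ψ ≤ l * ((k : ℝ) / m - z) ^ 2 := by
        calc 2 / ψ = l * (1 / (2 * m)) ^ 2 := by simp only [l]; field_simp; norm_num
          _ ≤ _ := mul_le_mul_of_nonneg_left hsq (by positivity)
      have hexp : 2 / ψ ≤ Real.exp (2 / ψ) := by linarith [Real.add_one_le_exp (2 / ψ)]
      calc Real.exp (-(l * ((k : ℝ) / m - z) ^ 2)) ≤ Real.exp (-(2 / ψ)) :=
            Real.exp_le_exp.2 (neg_le_neg hle)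
        _ ≤ (2 / ψ)⁻¹ := by rw [Real.exp_neg]; exact inv_anti₀ (by positivity) hexp
        _ = _ := by rw [inv_div]; ring
  refine (Finset.sum_le_sum fun k _ => hpt k).trans ?_
  rw [Finset.sum_add_distrib, Finset.sum_ite_mem, univ_inter]
  simp only [Finset.sum_const, nsmul_eq_mul, Finset.card_univ, Fintype.card_fin, mul_one]
  have h1 : (B.card : ℝ) ≤ 1 := by exact_mod_cast hB
  have h2 : 2 < m * ψ := (div_lt_iff₀ hψ).1 hm
  linarith

/-- Second moment of a sum of independent uniform vertices of the cube. -/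
theorem sum_norm_sum_sign_sq_le {n : ℕ} (hC : 0 ≤ C)
    (hg : ∀ k : Bool, |(bif k then 1 else -1 : ℝ)| ≤ 1) :
    ∑ x : Fin n → Fin d → Bool,
        ‖∑ i, (gridPoint hC (fun k : Bool => (bif k then 1 else -1 : ℝ)) hg (x i) :
          EuclideanSpace ℝ (Fin d))‖ ^ 2 ≤
      Fintype.card (Fin n → Fin d → Bool) * (n * C ^ 2) := by
  set e : (Fin d → Bool) → EuclideanSpace ℝ (Fin d) := fun v =>
    (gridPoint hC (fun k : Bool => (bif k then 1 else -1 : ℝ)) hg v : EuclideanSpace ℝ (Fin d))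
    with he
  -- Flipping all signs preserves the prior, so the vertices are centred.
  have hneg : ∀ v, e (fun j => !v j) = - e v := by
    intro v
    ext j
    simp only [he, gridPoint, PiLp.neg_apply]
    cases v j <;> simp
  have h0 : ∀ i : Fin n, ∑ x ∈ (univ : Finset (Fin n → Fin d → Bool)), e (x i) = 0 := by
    intro i
    have hinv : Function.Involutive fun (x : Fin n → Fin d → Bool) i j => !x i j := by
      intro x; simp
    have h := Equiv.sum_comp hinv.toPerm fun x => e (x i)
    simp only [Function.Involutive.coe_toPerm, hneg, Finset.sum_neg_distrib] at h
    rw [eq_comm, eq_neg_iff_add_eq_zero, ← two_smul ℝ] at h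
    exact (smul_eq_zero.1 h).resolve_left two_ne_zero
  rw [sum_norm_sum_sq univ (fun _ _ _ _ _ => mem_univ _) (fun _ => e) h0]
  calc _ ≤ ∑ _i : Fin n, ∑ _x : Fin n → Fin d → Bool, C ^ 2 := by
        refine Finset.sum_le_sum fun i _ => Finset.sum_le_sum fun x _ => ?_
        exact pow_le_pow_left₀ (norm_nonneg _) (mem_closedBall_zero_iff.1 (gridPoint hC _ hg _).2) 2
    _ = _ := by
        simp only [Finset.sum_const, nsmul_eq_mul, Finset.card_univ, Fintype.card_fin]
        ring

end Grid

/-! ### Bias and variance. -/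

section BiasVariance

variable {Ω E : Type*} [MeasurableSpace Ω] [NormedAddCommGroup E] [InnerProductSpace ℝ E]
  [CompleteSpace E]

/-- The bias-variance decomposition, for a variance that is bounded by `M`. -/
theorem integral_norm_sub_sq_le (P : Measure Ω) [IsProbabilityMeasure P] {W : Ω → E}
    (hW : Integrable W P) {μ : E} (hμ : ∫ ω, W ω ∂P = μ) {M : ℝ} (hM : 0 ≤ M)
    (hvar : ∫⁻ ω, ‖W ω - μ‖ₑ ^ 2 ∂P ≤ ENNReal.ofReal M) (c : E) :
    Integrable (fun ω => ‖W ω - c‖ ^ 2) P ∧ ∫ ω, ‖W ω - c‖ ^ 2 ∂P ≤ M + ‖μ - c‖ ^ 2 := by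
  have hD : Integrable (fun ω => W ω - μ) P := hW.sub (integrable_const μ)
  have hen : ∀ ω, ‖W ω - μ‖ₑ ^ 2 = ENNReal.ofReal (‖W ω - μ‖ ^ 2) := fun ω => by
    rw [ENNReal.ofReal_pow (norm_nonneg _), ofReal_norm]
  simp only [hen] at hvar
  have hmeas : AEStronglyMeasurable (fun ω => ‖W ω - μ‖ ^ 2) P := hD.1.norm.pow 2
  have hnn : 0 ≤ᵐ[P] fun ω => ‖W ω - μ‖ ^ 2 := Filter.Eventually.of_forall fun ω => by positivity
  have hint : Integrable (fun ω => ‖W ω - μ‖ ^ 2) P := by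
    refine ⟨hmeas, ?_⟩
    rw [hasFiniteIntegral_iff_ofReal hnn]
    exact hvar.trans_lt ENNReal.ofReal_lt_top
  have hle : ∫ ω, ‖W ω - μ‖ ^ 2 ∂P ≤ M := by
    rw [integral_eq_lintegral_of_nonneg_ae hnn hmeas]
    exact ENNReal.toReal_le_of_le_ofReal hM hvar
  have hpt : (fun ω => ‖W ω - c‖ ^ 2) = fun ω =>
      ‖W ω - μ‖ ^ 2 + 2 * inner ℝ (μ - c) (W ω - μ) + ‖μ - c‖ ^ 2 := by
    funext ω
    rw [real_inner_comm, ← norm_add_sq_real, sub_add_sub_cancel]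
  have hin : Integrable (fun ω => 2 * inner ℝ (μ - c) (W ω - μ)) P :=
    (hD.const_inner (μ - c)).const_mul 2
  have hsum : Integrable
      (fun ω => ‖W ω - μ‖ ^ 2 + 2 * inner ℝ (μ - c) (W ω - μ)) P := hint.add hin
  rw [hpt]
  refine ⟨hsum.add (integrable_const _), ?_⟩
  rw [integral_add hsum (integrable_const _), integral_add hint hin,
    integral_const_mul, integral_inner hD, integral_sub hW (integrable_const _), hμ]
  simpa using hle

end BiasVariance

/-! ### Two lower bounds for unbiased schemes. -/

namespace Compressor

open Finset

variable {Ω : Type*} {n d b : ℕ} {C : ℝ}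

/-- Lower bound for the worst-case error of an unbiased `b`-bit scheme, by a uniform prior on a
grid. -/
theorem IsBBit.card_mul_le_of_mse_le [MeasurableSpace Ω] (P : Measure Ω) [IsProbabilityMeasure P]
    {S : Compressor Ω (DataBall d C) (EuclideanSpace ℝ (Fin d)) n} (hS : S.IsBBit b)
    (hU : S.IsUnbiased P) {M : ℝ} (hM : 0 ≤ M) (hmse : ∀ x, S.mse P x ≤ ENNReal.ofReal M)
    (hd : 0 < d) (hC : 0 < C) {I : Type*} [Fintype I] (g : I → ℝ) (hg : ∀ k, |g k| ≤ 1) {l ψ : ℝ}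
    (hl : 0 < l) (hψ0 : 0 < ψ)
    (hψ : ∀ z, ∑ k, Real.exp (-(l * (g k - z) ^ 2)) ≤ Fintype.card I * ψ) {t : ℝ} (ht : 0 < t) :
    Fintype.card (Fin n → Fin d → I) *
        (t ^ 2 * (n * ((d * -Real.log ψ - b) / (l * d / C ^ 2)))) ≤
      Fintype.card (Fin n → Fin d → I) * M + (1 / n - t) ^ 2 *
        ∑ x : Fin n → Fin d → I,
          ‖∑ i, (gridPoint hC.le g hg (x i) : EuclideanSpace ℝ (Fin d))‖ ^ 2 := by
  have hd' : (0 : ℝ) < d := by exact_mod_cast hd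
  set e : (Fin d → I) → DataBall d C := gridPoint hC.le g hg
  set s : (Fin n → Fin d → I) → EuclideanSpace ℝ (Fin d) := fun x => ∑ i, (e (x i)).1
  set W : (Fin n → Fin d → I) → Ω → EuclideanSpace ℝ (Fin d) := fun x ω =>
    (1 / (n : ℝ)) • ∑ i, S.Y (e ∘ x) i ω
  have hx : ∀ x, Integrable (fun ω => ‖W x ω - t • s x‖ ^ 2) P ∧
      ∫ ω, ‖W x ω - t • s x‖ ^ 2 ∂P ≤ M + (1 / n - t) ^ 2 * ‖s x‖ ^ 2 := by
    intro x
    obtain ⟨h1, h2⟩ := hU (e ∘ x)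
    have h := integral_norm_sub_sq_le P (h1.smul (1 / (n : ℝ))) (μ := (1 / (n : ℝ)) • s x)
      (by
        simp only [Pi.smul_apply]
        rw [integral_smul, h2]
        rfl) hM (hmse (e ∘ x)) (t • s x)
    rw [← sub_smul, norm_smul, mul_pow, Real.norm_eq_abs, sq_abs] at h
    exact h
  -- The bound holds for each `ω` separately, so private and shared coins need no distinction.
  have hpt : ∀ ω, Fintype.card (Fin n → Fin d → I) *
      (t ^ 2 * (n * ((d * -Real.log ψ - b) / (l * d / C ^ 2)))) ≤ ∑ x, ‖W x ω - t • s x‖ ^ 2 := by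
    intro ω
    have h := hS.card_mul_le_sum_norm_sub_sq ω e (fun v => (v : EuclideanSpace ℝ (Fin d)))
      (pow_pos hψ0 d) (l := l * d / C ^ 2) (by positivity)
      (sum_exp_gridPoint_le hd hC g hg hψ)
      (fun h => (1 / (n : ℝ)) • ∑ i, S.report ω h i) ht
    rw [Real.log_pow, ← mul_neg] at h
    exact h
  have hint := integral_mono (μ := P) (integrable_const _)
    (integrable_finsetSum univ fun x _ => (hx x).1) hpt
  rw [integral_const, probReal_univ, one_smul, integral_finsetSum _ fun x _ => (hx x).1] at hint
  refine hint.trans ((Finset.sum_le_sum fun x _ => (hx x).2).trans_eq ?_)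
  rw [Finset.sum_add_distrib, Finset.sum_const, nsmul_eq_mul, Finset.card_univ, Finset.mul_sum]

/-- The case of the vertices of the cube. -/
theorem IsBBit.le_two_mul_of_mse_le [MeasurableSpace Ω] (P : Measure Ω) [IsProbabilityMeasure P]
    {S : Compressor Ω (DataBall d C) (EuclideanSpace ℝ (Fin d)) n} (hS : S.IsBBit b)
    (hU : S.IsUnbiased P) {r : ℝ} (hr : 0 ≤ r)
    (hmse : ∀ x, S.mse P x ≤ ENNReal.ofReal (C ^ 2 / n * r))
    (hn : 0 < n) (hd : 0 < d) (hC : 0 < C) : (d : ℝ) ≤ 2 * (r + 1) * b := by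
  have hd' : (0 : ℝ) < d := by exact_mod_cast hd
  have hn' : (0 : ℝ) < n := by exact_mod_cast hn
  have hg : ∀ k : Bool, |(bif k then 1 else -1 : ℝ)| ≤ 1 := by intro k; cases k <;> simp
  -- With `t = (r + 1) / n` this becomes `(r + 1)² (1 - 2b/d) ≤ r + r²`, informative for all `r`; `t
  -- = 1 / n` would give only `1 - 2b/d ≤ r`.
  have h := hS.card_mul_le_of_mse_le P hU (by positivity) hmse hd hC _ hg
    (by norm_num) (Real.exp_pos _) sum_exp_sign_le (t := (r + 1) / n) (by positivity)
  have h2 := sum_norm_sum_sign_sq_le (n := n) (d := d) hC.le hg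
  set N : ℝ := ((Fintype.card (Fin n → Fin d → Bool) : ℕ) : ℝ)
  have hN : 0 < N := by simp only [N]; exact_mod_cast Fintype.card_pos
  have h3 := h.trans (add_le_add_right (mul_le_mul_of_nonneg_left h2 (sq_nonneg _)) _)
  rw [Real.log_exp] at h3
  have h4 : N * C ^ 2 / n * ((r + 1) ^ 2 * (1 - 2 * b / d)) ≤
      N * C ^ 2 / n * (r + (1 - (r + 1)) ^ 2) := by
    refine le_of_eq_of_le ?_ (h3.trans_eq ?_)
    · field_simp
    · field_simp
  have h5 := le_of_mul_le_mul_left h4 (by positivity)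
  have h6 : (r + 1) * 1 ≤ (r + 1) * (2 * (r + 1) * b / d) := by
    linear_combination h5
  have h7 := le_of_mul_le_mul_left h6 (by positivity)
  rwa [le_div_iff₀ hd', one_mul] at h7

/-- A scheme with `O(d)` bits per client has an error of order at least `C² / n`. -/
theorem exists_le_mul_of_mse_le (A : ℝ) : ∃ l : ℝ, 0 < l ∧
    ∀ (Ω : Type*) [MeasurableSpace Ω] (P : Measure Ω) [IsProbabilityMeasure P] (n d b : ℕ) (C : ℝ)
      (S : Compressor Ω (DataBall d C) (EuclideanSpace ℝ (Fin d)) n), S.IsBBit b →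
      S.IsUnbiased P → ∀ r : ℝ, 0 ≤ r →
      (∀ x, S.mse P x ≤ ENNReal.ofReal (C ^ 2 / n * r)) → 0 < n → 0 < d → 0 < C →
      (b : ℝ) ≤ A * d → 1 ≤ l * r := by
  -- The exponent `A + 1` leaves `(A + 1) * d - b ≥ d` when `b ≤ A * d`.
  obtain ⟨m, l, g, hm, hl, hg, hψ⟩ := exists_grid_sum_exp_le (Real.exp_pos (-(A + 1)))
  refine ⟨l, hl, fun Ω _ P _ n d b C S hS hU r hr hmse hn hd hC hb => ?_⟩
  have hd' : (0 : ℝ) < d := by exact_mod_cast hd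
  have hn' : (0 : ℝ) < n := by exact_mod_cast hn
  have h := hS.card_mul_le_of_mse_le P hU (by positivity) hmse hd hC g hg hl (Real.exp_pos _) hψ
    (t := 1 / n) (by positivity)
  rw [sub_self, zero_pow two_ne_zero, zero_mul, add_zero, Real.log_exp] at h
  have : Nonempty (Fin m) := ⟨⟨0, hm⟩⟩
  have hN : (0 : ℝ) < Fintype.card (Fin n → Fin d → Fin m) := by exact_mod_cast Fintype.card_pos
  have h1 := le_of_mul_le_mul_left h hN
  have h2 : C ^ 2 / n * (((A + 1) * d - b) / (l * d)) ≤ C ^ 2 / n * r := by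
    refine le_of_eq_of_le ?_ h1
    field_simp
  have h3 := le_of_mul_le_mul_left h2 (by positivity)
  rw [div_le_iff₀ (by positivity)] at h3
  refine le_of_mul_le_mul_right ?_ hd'
  linarith

end Compressor

/-! ### Combining the two bounds. -/

theorem mainTheorem10 (K A : ℝ) (hK : 0 < K) (hA : 0 < A) :
    ∃ c : ℝ, 0 < c ∧
      ∀ (n d b : ℕ) (C ε δ : ℝ), 0 < n → 0 < d → 0 < C → 0 < ε → 0 < δ → δ < 1 →
      min (b : ℝ) (n * ε ^ 2 / Real.log (1 / δ)) ≤ A * d →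
      ∀ (Ω : Type*) [MeasurableSpace Ω] (P : Measure Ω) [IsProbabilityMeasure P]
        (S : Compressor Ω (DataBall d C) (EuclideanSpace ℝ (Fin d)) n),
        S.IsBBit b → S.IsUnbiased P →
        (∀ x : Fin n → DataBall d C,
          S.mse P x ≤
            ENNReal.ofReal (K * (C ^ 2 * d * Real.log (1 / δ) / (n ^ 2 * ε ^ 2)))) →
        c * (n * ε ^ 2 / Real.log (1 / δ)) ≤ b := by
  obtain ⟨l, hl, hfine⟩ := Compressor.exists_le_mul_of_mse_le A
  -- One constant for each of the cases `T ≤ A * d` and `T > A * d` below.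
  refine ⟨min (1 / (2 * (K + A))) (1 / (2 * (K / A + 1) * (l * K))), by positivity, ?_⟩
  intro n d b C ε δ hn hd hC hε hδ hδ1 hmin Ω _ P _ S hS hU hmse
  have hd' : (0 : ℝ) < d := by exact_mod_cast hd
  have hn' : (0 : ℝ) < n := by exact_mod_cast hn
  have hlog : 0 < Real.log (1 / δ) := Real.log_pos (by rw [lt_div_iff₀ hδ]; linarith)
  set T : ℝ := n * ε ^ 2 / Real.log (1 / δ) with hT
  have hT0 : 0 < T := by positivity
  have hr : K * (C ^ 2 * d * Real.log (1 / δ) / (n ^ 2 * ε ^ 2)) = C ^ 2 / n * (K * d / T) := by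
    rw [hT]
    field_simp
  rw [hr] at hmse
  have h1 : (d : ℝ) ≤ 2 * (K * d / T + 1) * b :=
    hS.le_two_mul_of_mse_le P hU (by positivity) hmse hn hd hC
  rcases le_or_gt T (A * d) with hTd | hTd
  · refine (mul_le_mul_of_nonneg_right (min_le_left _ _) hT0.le).trans ?_
    have h2 : K * d / T + 1 ≤ (K + A) * d / T := by
      rw [div_add_one hT0.ne']
      gcongr
      linarith
    have h3 : (d : ℝ) * 1 ≤ d * (2 * (K + A) * b / T) := by
      calc (d : ℝ) * 1 ≤ 2 * (K * d / T + 1) * b := by linarith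
        _ ≤ 2 * ((K + A) * d / T) * b := by gcongr
        _ = _ := by ring
    have h4 := le_of_mul_le_mul_left h3 hd'
    rw [le_div_iff₀ hT0] at h4
    rw [one_div_mul_eq_div, div_le_iff₀ (by positivity)]
    linarith
  · refine (mul_le_mul_of_nonneg_right (min_le_right _ _) hT0.le).trans ?_
    have hb : (b : ℝ) ≤ A * d := by
      rcases min_le_iff.1 hmin with h | h
      · exact h
      · exact absurd h (not_le.2 hTd)
    have h2 := hfine Ω P n d b C S hS hU (K * d / T) (by positivity) hmse hn hd hC hb
    have h3 : T ≤ l * K * d := by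
      rw [mul_div_assoc', le_div_iff₀ hT0] at h2
      linarith
    have h4 : K * d / T ≤ K / A := by
      rw [div_le_div_iff₀ hT0 hA]
      nlinarith
    have h5 : (d : ℝ) ≤ 2 * (K / A + 1) * b := h1.trans (by gcongr)
    rw [one_div_mul_eq_div, div_le_iff₀ (by positivity)]
    calc T ≤ l * K * d := h3
      _ ≤ l * K * (2 * (K / A + 1) * b) := by gcongr
      _ = _ := by ring
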